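/- **Definitions.** A semigroup $S$ is *regular* if every $a\in S$ satisfies $axa=a$ for some $x\in S$. On a regular semigroup put $a\le_\ell b\iff a\in Sb$ and $a\le_r b\iff a\in bS$; Green's relations $\mathscr L$ and $\mathscr R$ are the equivalence relations ${\le_\ell}\cap{\ge_\ell}$ and ${\le_r}\cap{\ge_r}$, and the set $S/\mathscr R$ of $\mathscr R$-classes is partially ordered by $\le_r$. A regular semigroup is *$\mathscr L$-unipotent* (resp. *$\mathscr R$-unipotent*) if each $\mathscr L$-class (resp. each $\mathscr R$-class) contains a unique idempotent. $\mathbf{LUS}$ and $\mathbf{RUS}$ are the categories of $\mathscr L$-unipotent and of $\mathscr R$-unipotent semigroups, with all semigroup homomorphisms as morphisms. Morphisms are composed from left to right. A *category with subobjects* is a small category $\mathcal C$ with a subcategory $\mathcal P$ having the same objects, whose morphisms are called *inclusions*, such that (1) there is at most one inclusion between two given objects, and two objects with inclusions in both directions are equal; (2) inclusions are monomorphisms of $\mathcal C$; (3) if $f=hg$ with $f,g\in\mathcal P$ and $h\in\mathcal C$, then $h\in\mathcal P$. A *retraction* is a morphism $q\colon b\to a$ such that $jq=1_a$ for some inclusion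 $j\colon a\to b$. A *cone* $\gamma$ in $\mathcal C$ with vertex $z=z_\gamma$ assigns to every object $c$ a morphism $\gamma(c)\colon c\to z$ such that $j\,\gamma(b)=\gamma(a)$ for every inclusion $j\colon a\to b$, and such that $\gamma(c)$ is an isomorphism for some $c$. The category $\mathcal C$ is *normal* if every inclusion $j\colon a\to b$ splits ($jq=1_a$ for some $q$), every morphism is of the form $quj$ with $q$ a retraction, $u$ an isomorphism and $j$ an inclusion, and for every object $c$ there is a cone $\mu$ with vertex $c$ and $\mu(c)=1_c$. In a normal category every morphism $f$ is uniquely of the form $f=f^\circ j$ with $f^\circ$ an epimorphism and $j$ an inclusion, and the set $\widehat{\mathcal C}$ of all cones is a regular semigroup under $(\gamma\cdot\delta)(c)=\gamma(c)\,(\delta(z_\gamma))^\circ$. Let $\mathcal C$ be a normal category and $\mathfrak D$ a down-set of the poset $\widehat{\mathcal C}/\mathscr R$. An object $c$ is *connected by* $\mathfrak d\in\mathfrak D$ if $\mathfrak d$ contains an idempotent cone with vertex $c$; this cone is then unique and is denoted $\epsilon(c,\mathfrak d)$. The pair $\mathcal C_{\mathfrak D}=(\mathcal C,\mathfrak D)$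 is a *connected category* if every object of $\mathcal C$ is connected by some $\mathfrak d\in\mathfrak D$, and a *supported category* if every object of $\mathcal C$ is connected by a unique $\mathfrak d\in\mathfrak D$. A morphism $\mathcal C_{\mathfrak D}\to\mathcal C'_{\mathfrak D'}$ of connected categories is a pair $(F,G)$ of a functor $F\colon\mathcal C\to\mathcal C'$ that maps inclusions to inclusions and an order preserving map $G\colon\mathfrak D\to\mathfrak D'$ such that, whenever $c$ is connected by $\mathfrak d$, the object $F(c)$ is connected by $G(\mathfrak d)$ and $F(\epsilon(c,\mathfrak d)(c'))=\epsilon(F(c),G(\mathfrak d))(F(c'))$ for every object $c'$ of $\mathcal C$. $\mathbf{SC}$ is the category of supported categories with these morphisms. **Theorem.** The category $\mathbf{LUS}$ of $\mathscr L$-unipotent semigroups is equivalent to the category $\mathbf{SC}$ of supported categories. Dually, the category $\mathbf{RUS}$ of $\mathscr R$-unipotent semigroups is also equivalent to $\mathbf{SC}$. -/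

import Mathlib

open CategoryTheory

universe u

namespace NormalCat

/-! ### Regular and unipotent semigroups -/

/-- A semigroup is (von Neumann) regular if every `a` satisfies `a x a = a` for some `x`. -/
def IsRegularSemigroup (S : Type u) [Semigroup S] : Prop :=
  ∀ a : S, ∃ x : S, a * x * a = a

/-- The quasi-order `a ≤ₗ b ↔ a ∈ S b`. -/
def LeL {S : Type u} [Mul S] (a b : S) : Prop := ∃ x : S, a = x * b

/-- The quasi-order `a ≤ᵣ b ↔ a ∈ b S`. -/
def LeR {S : Type u} [Mul S] (a b : S) : Prop := ∃ x : S, a = b * x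

/-- Green's relation `ℒ`. -/
def GreenL {S : Type u} [Mul S] (a b : S) : Prop := LeL a b ∧ LeL b a

/-- Green's relation `ℛ`. -/
def GreenR {S : Type u} [Mul S] (a b : S) : Prop := LeR a b ∧ LeR b a

/-- A regular semigroup in which each `ℒ`-class contains a unique idempotent. -/
def IsLUnipotent (S : Type u) [Semigroup S] : Prop :=
  IsRegularSemigroup S ∧ ∀ a : S, ∃! e : S, IsIdempotentElem e ∧ GreenL e a

/-- A regular semigroup in which each `ℛ`-class contains a unique idempotent. -/
def IsRUnipotent (S : Type u) [Semigroup S] : Prop :=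
  IsRegularSemigroup S ∧ ∀ a : S, ∃! e : S, IsIdempotentElem e ∧ GreenR e a

/-- The category of `ℒ`-unipotent semigroups and semigroup homomorphisms. -/
abbrev LUS : Type (u + 1) :=
  ObjectProperty.FullSubcategory (C := Semigrp.{u}) (fun S => IsLUnipotent S)

/-- The category of `ℛ`-unipotent semigroups and semigroup homomorphisms. -/
abbrev RUS : Type (u + 1) :=
  ObjectProperty.FullSubcategory (C := Semigrp.{u}) (fun S => IsRUnipotent S)

/-! ### Categories with subobjects -/

/-- A small category with subobjects: a wide subcategory `incl` (whose members are called
inclusions) that is a strict preorder, consists of monomorphisms, and contains `h` whenever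
it contains `g` and `h ≫ g`. -/
class CategoryWithSubobjects (C : Type u) [SmallCategory C] where
  incl : MorphismProperty C
  incl_id : ∀ a : C, incl (𝟙 a)
  incl_comp : ∀ {a b c : C} (f : a ⟶ b) (g : b ⟶ c), incl f → incl g → incl (f ≫ g)
  incl_unique : ∀ {a b : C} (f g : a ⟶ b), incl f → incl g → f = g
  incl_antisymm : ∀ {a b : C} (f : a ⟶ b) (g : b ⟶ a), incl f → incl g → a = b
  incl_mono : ∀ {a b : C} (f : a ⟶ b), incl f → Mono f
  incl_of_comp : ∀ {a b c : C} (h : a ⟶ b) (g : b ⟶ c), incl g → incl (h ≫ g) → incl h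

open CategoryWithSubobjects

section Subobjects

variable {C : Type u} [SmallCategory C] [CategoryWithSubobjects C]

/-- A retraction is a right inverse of an inclusion (in the order of composition). -/
def IsRetraction {a b : C} (q : b ⟶ a) : Prop :=
  ∃ j : a ⟶ b, incl j ∧ j ≫ q = 𝟙 a

/-- A cone with vertex `z`. -/
structure ConeAt (z : C) where
  app : ∀ c : C, c ⟶ z
  incl_app : ∀ {a b : C} (j : a ⟶ b), incl j → j ≫ app b = app a
  exists_iso : ∃ c : C, IsIso (app c)

end Subobjects

/-- A normal category. -/
class NormalCategory (C : Type u) [SmallCategory C] extends CategoryWithSubobjects C where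
  /-- every inclusion splits -/
  incl_splits : ∀ {a b : C} (j : a ⟶ b), incl j → ∃ q : b ⟶ a, j ≫ q = 𝟙 a
  /-- every morphism is a retraction, followed by an isomorphism, followed by an inclusion -/
  normal_factorisation : ∀ {c d : C} (f : c ⟶ d), ∃ (a b : C) (q : c ⟶ a) (v : a ⟶ b)
    (j : b ⟶ d), IsRetraction q ∧ IsIso v ∧ incl j ∧ f = q ≫ v ≫ j
  exists_idem_cone : ∀ c : C, ∃ μ : ConeAt c, μ.app c = 𝟙 c

open NormalCategory

/-- The cones of a small category with subobjects, with arbitrary vertex. -/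
structure Cone (C : Type u) [SmallCategory C] [CategoryWithSubobjects C] where
  vertex : C
  toConeAt : ConeAt vertex

section Normal

variable {C : Type u} [SmallCategory C]

/-- The component of a cone at an object. -/
abbrev Cone.app [CategoryWithSubobjects C] (γ : Cone C) (c : C) : c ⟶ γ.vertex :=
  γ.toConeAt.app c

theorem Cone.ext_of [CategoryWithSubobjects C] {γ δ : Cone C} (h : γ.vertex = δ.vertex)
    (happ : ∀ c, γ.app c ≫ eqToHom h = δ.app c) : γ = δ := by
  obtain ⟨z, γ⟩ := γ
  obtain ⟨w, δ⟩ := δ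
  obtain rfl : z = w := h
  obtain ⟨f, _, _⟩ := γ
  obtain ⟨g, _, _⟩ := δ
  obtain rfl : f = g := by
    funext c
    simpa [Cone.app] using happ c
  rfl

theorem Cone.app_eq [CategoryWithSubobjects C] {γ δ : Cone C} (h : γ = δ) :
    ∃ hv : γ.vertex = δ.vertex, ∀ c, γ.app c ≫ eqToHom hv = δ.app c := by
  subst h
  exact ⟨rfl, fun c => by simp⟩

variable [NormalCategory C]

theorem canonical_exists {c d : C} (f : c ⟶ d) :
    ∃ (b : C) (p : c ⟶ b) (j : b ⟶ d), Epi p ∧ incl j ∧ f = p ≫ j := by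
  obtain ⟨a, b, q, v, j, ⟨i, _, hi⟩, hv, hj, rfl⟩ := normal_factorisation f
  have : IsSplitEpi q := ⟨⟨⟨i, hi⟩⟩⟩
  exact ⟨b, q ≫ v, j, inferInstance, hj, by simp⟩

/-- The image of a morphism. -/
noncomputable def im {c d : C} (f : c ⟶ d) : C := (canonical_exists f).choose

/-- The epimorphic component of a morphism: the epimorphism in its (unique) factorisation as an
epimorphism followed by an inclusion. -/
noncomputable def epiPart {c d : C} (f : c ⟶ d) : c ⟶ im f :=
  (canonical_exists f).choose_spec.choose

/-- The inclusion of the image of a morphism in its codomain. -/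
noncomputable def imIncl {c d : C} (f : c ⟶ d) : im f ⟶ d :=
  (canonical_exists f).choose_spec.choose_spec.choose

instance epi_epiPart {c d : C} (f : c ⟶ d) : Epi (epiPart f) :=
  (canonical_exists f).choose_spec.choose_spec.choose_spec.1

theorem incl_imIncl {c d : C} (f : c ⟶ d) : incl (imIncl f) :=
  (canonical_exists f).choose_spec.choose_spec.choose_spec.2.1

theorem epiPart_imIncl {c d : C} (f : c ⟶ d) : epiPart f ≫ imIncl f = f :=
  (canonical_exists f).choose_spec.choose_spec.choose_spec.2.2.symm

/-- An inclusion that is an epimorphism is an identity. -/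
theorem incl_epi {a b : C} (j : a ⟶ b) (hj : incl j) [Epi j] :
    ∃ h : a = b, j = eqToHom h := by
  obtain ⟨r, hr⟩ := incl_splits j hj
  have hrj : r ≫ j = 𝟙 b := by
    rw [← cancel_epi j, ← Category.assoc, hr]; simp
  have hr' : incl r := incl_of_comp r j hj (by rw [hrj]; exact incl_id b)
  obtain rfl := incl_antisymm j r hj hr'
  exact ⟨rfl, incl_unique _ _ hj (incl_id _)⟩

/-- Every epimorphism is a retraction followed by an isomorphism. -/
theorem epi_factor {c d : C} (p : c ⟶ d) [Epi p] :
    ∃ (a : C) (q : c ⟶ a) (v : a ⟶ d), IsRetraction q ∧ IsIso v ∧ p = q ≫ v := by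
  obtain ⟨a, b, q, v, j, hq, hv, hj, rfl⟩ := normal_factorisation p
  have : Epi ((q ≫ v) ≫ j) := by simpa using ‹Epi (q ≫ v ≫ j)›
  have : Epi j := epi_of_epi (q ≫ v) j
  obtain ⟨rfl, rfl⟩ := incl_epi j hj
  exact ⟨a, q, v, hq, hv, by simp⟩

/-- Uniqueness of the canonical factorisation. -/
theorem canonical_unique {c b b' d : C} {p : c ⟶ b} {p' : c ⟶ b'} {j : b ⟶ d} {j' : b' ⟶ d}
    [Epi p] [Epi p'] (hj : incl j) (hj' : incl j') (h : p ≫ j = p' ≫ j') :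
    ∃ hb : b = b', p ≫ eqToHom hb = p' := by
  have key : ∀ {b b' : C} {p : c ⟶ b} {p' : c ⟶ b'} {j : b ⟶ d} {j' : b' ⟶ d} [Epi p]
      (_ : incl j) (_ : incl j') (_ : p ≫ j = p' ≫ j'), ∃ k : b ⟶ b', incl k := by
    intro b b' p p' j j' _ hj hj' h
    obtain ⟨a, q, v, ⟨i, _, hi⟩, hv, rfl⟩ := epi_factor p
    have e : j = (inv v ≫ i ≫ p') ≫ j' := by
      have := congrArg (fun t => inv v ≫ i ≫ t) h
      simp only [Category.assoc] at this
      rw [← Category.assoc i q, hi] at this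
      simpa using this
    exact ⟨_, incl_of_comp _ j' hj' (e ▸ hj)⟩
  obtain ⟨k, hk⟩ := key hj hj' h
  obtain ⟨k', hk'⟩ := key hj' hj h.symm
  obtain rfl := incl_antisymm k k' hk hk'
  obtain rfl := incl_unique j j' hj hj'
  have := incl_mono j hj
  refine ⟨rfl, ?_⟩
  rw [← cancel_mono j]
  simpa using h

theorem epiPart_unique {c b d : C} {f : c ⟶ d} (p : c ⟶ b) (j : b ⟶ d) [Epi p] (hj : incl j)
    (h : f = p ≫ j) : ∃ hb : im f = b, epiPart f ≫ eqToHom hb = p :=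
  canonical_unique (incl_imIncl f) hj (by rw [epiPart_imIncl, h])

/-- The cone `γ ∗ p` with components `γ(c) p`, for an epimorphism `p`. -/
def ConeAt.star {z w : C} (γ : ConeAt z) (p : z ⟶ w) [Epi p] : ConeAt w where
  app c := γ.app c ≫ p
  incl_app j hj := by rw [← Category.assoc, γ.incl_app j hj]
  exists_iso := by
    obtain ⟨c, hc⟩ := γ.exists_iso
    obtain ⟨a, q, v, ⟨i, _, hi⟩, hv, rfl⟩ := epi_factor p
    obtain ⟨a', b', q', v', j, ⟨i', _, hi'⟩, hv', hj, h⟩ :=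
      normal_factorisation (i ≫ inv (γ.app c))
    have hs : IsSplitMono i := ⟨⟨⟨q, hi⟩⟩⟩
    have hs' : IsSplitEpi q' := ⟨⟨⟨i', hi'⟩⟩⟩
    have hm : Mono (q' ≫ v' ≫ j) := by rw [← h]; infer_instance
    have hm' : Mono q' := mono_of_mono q' (v' ≫ j)
    have hq' : IsIso q' := isIso_of_mono_of_isSplitEpi q'
    refine ⟨b', ?_⟩
    have e : γ.app b' = inv (q' ≫ v') ≫ i := by
      rw [← γ.incl_app j hj, IsIso.eq_inv_comp]
      have := congrArg (fun t => t ≫ γ.app c) h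
      simpa using this.symm
    have : γ.app b' ≫ q ≫ v = inv (q' ≫ v') ≫ v := by
      rw [e, Category.assoc, ← Category.assoc i q, hi, Category.id_comp]
    rw [this]
    infer_instance

/-- The binary composition of cones `γ · δ = γ ∗ (δ(z_γ))°`. -/
noncomputable instance : Mul (Cone C) where
  mul γ δ := ⟨im (δ.app γ.vertex), γ.toConeAt.star (epiPart (δ.app γ.vertex))⟩

theorem Cone.mul_app (γ δ : Cone C) (c : C) :
    (γ * δ).app c = γ.app c ≫ epiPart (δ.app γ.vertex) := rfl

/-- To recognise a product of cones it is enough to give some canonical factorisation. -/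
theorem Cone.mul_eq_of {γ δ η : Cone C} (p : γ.vertex ⟶ η.vertex) (j : η.vertex ⟶ δ.vertex)
    [Epi p] (hj : incl j) (h : δ.app γ.vertex = p ≫ j) (happ : ∀ c, η.app c = γ.app c ≫ p) :
    γ * δ = η := by
  obtain ⟨hb, hp⟩ := epiPart_unique p j hj h
  exact Cone.ext_of hb fun c => by rw [Cone.mul_app, Category.assoc, hp, happ]

theorem incl_eqToHom_comp {a b c : C} (h : a = b) (j : b ⟶ c) (hj : incl j) :
    incl (eqToHom h ≫ j) := by
  subst h
  simpa using hj

noncomputable instance : Semigroup (Cone C) where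
  mul_assoc γ δ η := by
    symm
    obtain ⟨hb, hp⟩ := epiPart_unique (f := η.app (γ * δ).vertex)
      (epiPart (imIncl (δ.app γ.vertex) ≫ epiPart (η.app δ.vertex)))
      (imIncl (imIncl (δ.app γ.vertex) ≫ epiPart (η.app δ.vertex)) ≫ imIncl (η.app δ.vertex))
      (incl_comp _ _ (incl_imIncl _) (incl_imIncl _))
      (by
        rw [← Category.assoc, epiPart_imIncl, Category.assoc, epiPart_imIncl]
        exact (η.toConeAt.incl_app _ (incl_imIncl _)).symm)
    have hepi : Epi (epiPart (δ.app γ.vertex) ≫ epiPart (η.app (γ * δ).vertex)) :=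
      epi_comp (epiPart (δ.app γ.vertex)) (epiPart (η.app (γ * δ).vertex))
    refine Cone.mul_eq_of (η := γ * δ * η)
      (epiPart (δ.app γ.vertex) ≫ epiPart (η.app (γ * δ).vertex))
      (eqToHom hb ≫ imIncl (imIncl (δ.app γ.vertex) ≫ epiPart (η.app δ.vertex)))
      (incl_eqToHom_comp hb _ (incl_imIncl _)) ?_ ?_
    · have e : (epiPart (δ.app γ.vertex) ≫ epiPart (η.app (γ * δ).vertex)) ≫
          (eqToHom hb ≫ imIncl (imIncl (δ.app γ.vertex) ≫ epiPart (η.app δ.vertex))) =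
          epiPart (δ.app γ.vertex) ≫ (epiPart (η.app (γ * δ).vertex) ≫ eqToHom hb) ≫
            imIncl (imIncl (δ.app γ.vertex) ≫ epiPart (η.app δ.vertex)) := by
        simp only [Category.assoc]
      rw [e, hp, epiPart_imIncl, ← Category.assoc, epiPart_imIncl]
      rfl
    · intro c
      rw [Cone.mul_app, Cone.mul_app, Category.assoc]

/-- If `μ` has the same vertex as `γ` and is the identity there, then `γ μ = γ`. -/
theorem Cone.mul_of_app_vertex {γ μ : Cone C} (h : γ.vertex = μ.vertex)
    (hμ : μ.app γ.vertex = eqToHom h) : γ * μ = γ := by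
  refine Cone.mul_eq_of (𝟙 _) (eqToHom h) ?_ (by simp [hμ]) (by simp)
  simpa using incl_eqToHom_comp h _ (incl_id _)

/-- The component of an idempotent cone at its own vertex is the identity. -/
theorem Cone.app_vertex_of_idem {μ : Cone C} (hμ : IsIdempotentElem μ) :
    μ.app μ.vertex = 𝟙 μ.vertex := by
  obtain ⟨hv, happ⟩ := Cone.app_eq hμ
  obtain ⟨c, hc⟩ := μ.toConeAt.exists_iso
  have h1 := happ c
  rw [Cone.mul_app, Category.assoc] at h1
  have h2 : epiPart (μ.app μ.vertex) ≫ eqToHom hv = 𝟙 _ := by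
    have hc' : IsIso (μ.app c) := hc
    rw [← cancel_epi (μ.app c), h1, Category.comp_id]
  have h3 : imIncl (μ.app μ.vertex) = eqToHom hv := by
    refine incl_unique _ _ (incl_imIncl _) ?_
    simpa using incl_eqToHom_comp hv _ (incl_id _)
  rw [← h2, ← h3, epiPart_imIncl]

/-- The cones, quasi-ordered by `γ ≤ δ ↔ γ ∈ δ Ĉ`. -/
noncomputable instance : Preorder (Cone C) where
  le := LeR
  le_refl γ := by
    obtain ⟨μ, hμ⟩ := exists_idem_cone γ.vertex
    exact ⟨⟨γ.vertex, μ⟩, (Cone.mul_of_app_vertex (γ := γ) (μ := ⟨γ.vertex, μ⟩) rfl hμ).symm⟩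
  le_trans γ δ η := by
    rintro ⟨x, rfl⟩ ⟨y, rfl⟩
    exact ⟨y * x, mul_assoc η y x⟩

variable (C) in
/-- The poset of `ℛ`-classes of the semigroup of cones. -/
abbrev RClasses : Type u := Antisymmetrization (Cone C) (· ≤ ·)

/-- The `ℛ`-class of a cone. -/
def rClass (γ : Cone C) : RClasses C := toAntisymmetrization (· ≤ ·) γ

theorem rClass_eq_iff (γ δ : Cone C) : rClass γ = rClass δ ↔ GreenR γ δ :=
  Quotient.eq

theorem rClass_le_iff (γ δ : Cone C) : rClass γ ≤ rClass δ ↔ LeR γ δ :=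
  Iff.rfl

/-- The object `c` is connected by the `ℛ`-class `d` if `d` contains an idempotent cone with
vertex `c`. -/
def ConnectedBy (c : C) (d : RClasses C) : Prop :=
  ∃ ε : ConeAt c, IsIdempotentElem (⟨c, ε⟩ : Cone C) ∧ rClass ⟨c, ε⟩ = d

/-- The idempotent cone `ε(c, d)` with vertex `c` in the `ℛ`-class `d`. -/
noncomputable def idemCone {c : C} {d : RClasses C} (h : ConnectedBy c d) : ConeAt c :=
  h.choose

theorem idemCone_idem {c : C} {d : RClasses C} (h : ConnectedBy c d) :
    IsIdempotentElem (⟨c, idemCone h⟩ : Cone C) :=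
  h.choose_spec.1

theorem rClass_idemCone {c : C} {d : RClasses C} (h : ConnectedBy c d) :
    rClass ⟨c, idemCone h⟩ = d :=
  h.choose_spec.2

/-- An idempotent cone is determined by its vertex and its `ℛ`-class. -/
theorem idemCone_unique {c : C} {d : RClasses C} (h : ConnectedBy c d) (ε : ConeAt c)
    (hε : IsIdempotentElem (⟨c, ε⟩ : Cone C)) (hd : rClass ⟨c, ε⟩ = d) :
    ε = idemCone h := by
  have hr : GreenR (⟨c, ε⟩ : Cone C) ⟨c, idemCone h⟩ := by
    rw [← rClass_eq_iff, hd, rClass_idemCone]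
  obtain ⟨x, hx⟩ := hr.1
  have h1 : (⟨c, idemCone h⟩ : Cone C) * ⟨c, ε⟩ = ⟨c, ε⟩ := by
    rw [hx, ← mul_assoc, (idemCone_idem h).eq]
  have h2 : (⟨c, idemCone h⟩ : Cone C) * ⟨c, ε⟩ = ⟨c, idemCone h⟩ :=
    Cone.mul_of_app_vertex rfl (Cone.app_vertex_of_idem hε)
  have h3 : (⟨c, ε⟩ : Cone C) = ⟨c, idemCone h⟩ := h1.symm.trans h2
  cases h3
  rfl

end Normal

/-! ### Connected and supported categories -/

/-- A connected category: a small normal category with a down-set `D` of the poset of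
`ℛ`-classes of its semigroup of cones, such that each object is connected by a member of `D`. -/
structure ConnectedCat : Type (u + 1) where
  carrier : Type u
  [cat : SmallCategory carrier]
  [normal : NormalCategory carrier]
  D : LowerSet (RClasses carrier)
  connected : ∀ c : carrier, ∃ d ∈ D, ConnectedBy c d

attribute [instance] ConnectedCat.cat ConnectedCat.normal

/-- A morphism of connected categories: an inclusion preserving functor `F` with an order
preserving map `G` between the down-sets, such that `F c` is connected by `G d` and
`F (ε(c, d)(c')) = ε(F c, G d)(F c')` whenever `c` is connected by `d`. -/
@[ext]
structure CCHom (X Y : ConnectedCat.{u}) : Type u where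
  F : X.carrier ⥤ Y.carrier
  G : X.D →o Y.D
  map_incl : ∀ {a b : X.carrier} (j : a ⟶ b), incl j → incl (F.map j)
  map_connected : ∀ {c : X.carrier} {d : X.D}, ConnectedBy c d.1 → ConnectedBy (F.obj c) (G d).1
  map_idemCone : ∀ {c : X.carrier} {d : X.D} (h : ConnectedBy c d.1) (c' : X.carrier),
    F.map ((idemCone h).app c') = (idemCone (map_connected h)).app (F.obj c')

/-- The category of connected categories. -/
noncomputable instance : Category ConnectedCat.{u} where
  Hom := CCHom
  id X :=
    { F := 𝟭 _
      G := OrderHom.id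
      map_incl := fun _ hj => hj
      map_connected := fun h => h
      map_idemCone := fun _ _ => rfl }
  comp m n :=
    { F := m.F ⋙ n.F
      G := n.G.comp m.G
      map_incl := fun j hj => n.map_incl _ (m.map_incl j hj)
      map_connected := fun h => n.map_connected (m.map_connected h)
      map_idemCone := fun h c' => by
        rw [Functor.comp_map, m.map_idemCone h c', n.map_idemCone]
        rfl }

/-- A connected category is supported if each object is connected by a unique member of `D`. -/
def IsSupported (X : ConnectedCat.{u}) : Prop :=
  ∀ c : X.carrier, ∃! d : X.D, ConnectedBy c d.1

/-- The category of supported categories, a full subcategory of that of connected categories. -/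
abbrev SC : Type (u + 1) :=
  ObjectProperty.FullSubcategory (C := ConnectedCat.{u}) IsSupported

end NormalCat

/-!
The equivalence sends a supported category `X` to the semigroup of those cones whose `ℛ`-class
belongs to its down-set. Each object `c` of `X` carries a single idempotent cone `ε(c)` in this
semigroup, and `f ↦ ε(a) ∗ f°` identifies the morphisms `f : a ⟶ b` with the elements `γ` such that
`ε(a) γ = γ = γ ε(b)` (`homCone_injective`, `exists_homCone_eq`). So `X` is recovered from the
semigroup as its category of idempotents. Every element has this form, and the elements are
multiplied by `homCone_mul`, which involves only composition and the cones `ε(c)`.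

* Morphisms (`CCHom.mulHom`, `ccHomOfMulHom`). A morphism of supported categories preserves
  composition, inclusions and the cones `ε(c)`, hence the multiplication. That it respects
  equality of cones rests on `IsLUnipotent.eq_of_idem_mul`: in an `ℒ`-unipotent semigroup,
  elements `a = e b` and `b = g a` with `e`, `g` idempotent are equal. Conversely a homomorphism acts
  on the category of idempotents. Its action on the down-sets is forced, since each member of the
  down-set is the class of some `ε(c)`.
* Objects (`principalConeEquiv`). The idempotents of an `ℒ`-unipotent semigroup `S` form a normal
  category, in which `a ∈ S` gives the principal cone of right translations by `a`. The map from
  `S` to cones is injective, again by `IsLUnipotent.eq_of_idem_mul`, and its image is a right ideal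
  of the semigroup of cones (`principalCone_mul_cone`). Its `ℛ`-classes thus form a down-set, and
  the resulting category is supported because each `ℒ`-class of `S` has a single idempotent.

The `ℛ`-unipotent semigroups are the opposites of the `ℒ`-unipotent ones.
-/

namespace NormalCat

open CategoryWithSubobjects NormalCategory

/-! ### Idempotents of an `ℒ`-unipotent semigroup -/

section Semigroups

variable {S : Type u} [Semigroup S]

theorem greenL_refl {e : S} (he : IsIdempotentElem e) : GreenL e e :=
  ⟨⟨e, he.eq.symm⟩, ⟨e, he.eq.symm⟩⟩

theorem mul_eq_of_leR_idem {e a : S} (he : IsIdempotentElem e) (h : LeR a e) : e * a = a := by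
  obtain ⟨x, rfl⟩ := h
  rw [← mul_assoc, he.eq]

theorem mul_eq_of_greenL {a e : S} (he : IsIdempotentElem e) (h : GreenL e a) : a * e = a := by
  obtain ⟨x, hx⟩ := h.2
  rw [hx, mul_assoc, he.eq]

theorem IsLUnipotent.eq_of_idem (h : IsLUnipotent S) {e f : S} (he : IsIdempotentElem e)
    (hf : IsIdempotentElem f) (hef : e * f = e) (hfe : f * e = f) : e = f :=
  (h.2 f).unique ⟨he, ⟨e, hef.symm⟩, ⟨f, hfe.symm⟩⟩ ⟨hf, ⟨f, hf.eq.symm⟩, ⟨f, hf.eq.symm⟩⟩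

/-- In an `ℒ`-unipotent semigroup the idempotents satisfy `e f e = f e`. -/
theorem IsLUnipotent.idem_mul_idem_mul (h : IsLUnipotent S) {e f : S} (he : IsIdempotentElem e)
    (hf : IsIdempotentElem f) : e * (f * e) = f * e := by
  obtain ⟨y, hy⟩ := h.1 (f * e)
  have he' : ∀ t, e * (e * t) = e * t := fun t => by rw [← mul_assoc, he.eq]
  have hf' : ∀ t, f * (f * t) = f * t := fun t => by rw [← mul_assoc, hf.eq]
  have hy' : ∀ t, f * (e * (y * (f * (e * t)))) = f * (e * t) := fun t => by
    have := congrArg (· * t) hy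
    simpa only [mul_assoc] using this
  have hy0 : f * (e * (y * (f * e))) = f * e := by simpa only [mul_assoc] using hy
  -- `k = e (y f e y) f` and `f k` are `ℒ`-related idempotents with `f e = f k e`,
  -- so that `f k = k` and `f e = k e`
  have hk : IsIdempotentElem (e * (y * (f * (e * (y * f))))) := by
    simp only [IsIdempotentElem, mul_assoc, hy']
  have hfk : IsIdempotentElem (f * (e * (y * (f * (e * (y * f)))))) := by
    simp only [IsIdempotentElem, mul_assoc, hf', hy']
  have key := h.eq_of_idem hfk hk (by simp only [mul_assoc, hy'])
    (by simp only [mul_assoc, hf', hy'])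
  have h1 : f * e = f * (e * (y * (f * (e * (y * f))))) * e := by
    simp only [mul_assoc, hy', hy0]
  rw [h1, key]
  simp only [mul_assoc, he']

/-- In an `ℒ`-unipotent semigroup, elements that are carried to one another by left multiplication
by idempotents are equal. -/
theorem IsLUnipotent.eq_of_idem_mul (h : IsLUnipotent S) {e g a b : S} (he : IsIdempotentElem e)
    (hg : IsIdempotentElem g) (hab : a = e * b) (hba : b = g * a) : a = b := by
  have hea : e * a = a := by rw [hab, ← mul_assoc, he.eq]
  calc a = e * (g * (e * a)) := by rw [hea, ← hba, ← hab]
    _ = e * (g * e) * a := by simp only [mul_assoc]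
    _ = b := by rw [h.idem_mul_idem_mul he hg, mul_assoc, hea, ← hba]

end Semigroups

/-! ### Cones of a normal category -/

section Cones

variable {C : Type u} [SmallCategory C] [NormalCategory C]

theorem isSplitEpi_of_epi {c d : C} (p : c ⟶ d) [Epi p] : IsSplitEpi p := by
  obtain ⟨a, q, v, ⟨i, _, hi⟩, hv, rfl⟩ := epi_factor p
  exact ⟨⟨⟨inv v ≫ i, by rw [Category.assoc, ← Category.assoc i, hi]; simp⟩⟩⟩

theorem isIdempotentElem_of_app_vertex {c : C} (ε : ConeAt c) (h : ε.app c = 𝟙 c) :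
    IsIdempotentElem (⟨c, ε⟩ : Cone C) :=
  Cone.mul_of_app_vertex rfl h

theorem leR_star {z w : C} (γ : ConeAt z) (p : z ⟶ w) [Epi p] :
    LeR (⟨w, γ.star p⟩ : Cone C) ⟨z, γ⟩ := by
  obtain ⟨μ, hμ⟩ := exists_idem_cone z
  refine ⟨⟨w, μ.star p⟩, (Cone.mul_eq_of p (𝟙 w) (incl_id w) ?_ fun _ => rfl).symm⟩
  change μ.app z ≫ p = p ≫ 𝟙 w
  rw [hμ]; simp

/-- The vertex of a product of cones is a subobject of the vertex of the second factor. -/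
theorem exists_incl_of_mul_eq {γ δ η : Cone C} (h : γ * δ = η) :
    ∃ j : η.vertex ⟶ δ.vertex, incl j := by
  subst h
  exact ⟨imIncl (δ.app γ.vertex), incl_imIncl _⟩

/-- Every cone is an idempotent cone followed by an isomorphism. -/
theorem Cone.exists_idem_star (γ : Cone C) : ∃ (c z : C) (ε : ConeAt c) (v : c ⟶ z)
    (_ : IsIso v), ε.app c = 𝟙 c ∧ γ = ⟨z, ε.star v⟩ := by
  obtain ⟨z, γ⟩ := γ
  obtain ⟨c, hc⟩ := γ.exists_iso
  refine ⟨c, z, γ.star (inv (γ.app c)), γ.app c, hc, by simp [ConeAt.star], ?_⟩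
  obtain ⟨f, _, _⟩ := γ
  simp [ConeAt.star]

section Idempotents

variable (E : ∀ c : C, ConeAt c)

/-- For a choice `E` of a cone at each object, the cone `E(a) ∗ f°` given by a morphism `f` with
domain `a`. -/
noncomputable def coneOf {a b : C} (f : a ⟶ b) : Cone C :=
  ⟨im f, (E a).star (epiPart f)⟩

theorem coneOf_eq {a b m : C} {f : a ⟶ b} (p : a ⟶ m) (j : m ⟶ b) [Epi p] (hj : incl j)
    (h : f = p ≫ j) : coneOf E f = ⟨m, (E a).star p⟩ := by
  obtain ⟨hb, hp⟩ := epiPart_unique p j hj h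
  exact Cone.ext_of hb fun c => by
    exact (Category.assoc _ _ _).trans (congrArg ((E a).app c ≫ ·) hp)

theorem coneOf_epi {a b : C} (f : a ⟶ b) [Epi f] : coneOf E f = ⟨b, (E a).star f⟩ :=
  coneOf_eq E f (𝟙 b) (incl_id b) (by simp)

theorem coneOf_id (a : C) : coneOf E (𝟙 a) = ⟨a, E a⟩ := by
  rw [coneOf_epi]
  exact Cone.ext_of rfl fun c => by simp [Cone.app, ConeAt.star]

theorem coneOf_comp_incl {a b c : C} (f : a ⟶ b) (j : b ⟶ c) (hj : incl j) :
    coneOf E (f ≫ j) = coneOf E f :=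
  coneOf_eq E (epiPart f) (imIncl f ≫ j) (incl_comp _ _ (incl_imIncl f) hj)
    (by rw [← Category.assoc, epiPart_imIncl])

theorem coneOf_incl {a b : C} (j : a ⟶ b) (hj : incl j) : coneOf E j = coneOf E (𝟙 a) := by
  simpa using coneOf_comp_incl E (𝟙 a) j hj

theorem mul_eq_coneOf (a : C) (γ : Cone C) : (⟨a, E a⟩ : Cone C) * γ = coneOf E (γ.app a) :=
  rfl

theorem leR_coneOf {a b : C} (f : a ⟶ b) : LeR (coneOf E f) ⟨a, E a⟩ :=
  leR_star _ _

/-- The cones `E(a) ∗ f°` are multiplied by composing the morphisms through a component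
of `E`. -/
theorem coneOf_mul {a b c d : C} (f : a ⟶ b) (g : c ⟶ d) :
    coneOf E f * coneOf E g = coneOf E (f ≫ (E c).app b ≫ g) := by
  set t : im f ⟶ im g := (E c).app (im f) ≫ epiPart g with ht
  have hepi : Epi (epiPart f ≫ epiPart t) := epi_comp (epiPart f) _
  rw [coneOf_eq E (epiPart f ≫ epiPart t) (imIncl t ≫ imIncl g)
    (incl_comp _ _ (incl_imIncl _) (incl_imIncl g))]
  · exact @Cone.mul_eq_of C _ _ (coneOf E f) (coneOf E g)
      ⟨im t, (E a).star (epiPart f ≫ epiPart t)⟩ (epiPart t) (imIncl t) (epi_epiPart t)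
      (incl_imIncl t) (epiPart_imIncl t).symm fun x => (Category.assoc _ _ _).symm
  · rw [Category.assoc, ← Category.assoc (epiPart t), epiPart_imIncl, ht, Category.assoc,
      epiPart_imIncl, ← (E c).incl_app (imIncl f) (incl_imIncl f), Category.assoc,
      ← Category.assoc (epiPart f), epiPart_imIncl]

/-- The cones `γ` with `E(a) γ = γ = γ E(b)` are those given by the morphisms from `a` to `b`. -/
theorem exists_coneOf_eq {a b : C} {γ : Cone C} (ha : (⟨a, E a⟩ : Cone C) * γ = γ)
    (hb : γ * (⟨b, E b⟩ : Cone C) = γ) : ∃ f : a ⟶ b, coneOf E f = γ := by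
  obtain ⟨j, hj⟩ := exists_incl_of_mul_eq hb
  refine ⟨γ.app a ≫ j, ?_⟩
  rw [coneOf_comp_incl E _ j hj, ← mul_eq_coneOf, ha]

variable {E}
variable (hE : ∀ c, (E c).app c = 𝟙 c)
include hE

theorem coneOf_comp {a b c : C} (f : a ⟶ b) (g : b ⟶ c) :
    coneOf E (f ≫ g) = coneOf E f * coneOf E g := by
  rw [coneOf_mul, hE, Category.id_comp]

/-- Two morphisms with the same domain and the same cone have the same epimorphic component. -/
theorem exists_factor_of_coneOf_eq {a b d : C} {f : a ⟶ b} {g : a ⟶ d}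
    (h : coneOf E f = coneOf E g) : ∃ (m : C) (p : a ⟶ m) (j : m ⟶ b) (k : m ⟶ d),
      incl j ∧ incl k ∧ f = p ≫ j ∧ g = p ≫ k := by
  obtain ⟨hv, happ⟩ := Cone.app_eq h
  have hp := happ a
  change ((E a).app a ≫ epiPart f) ≫ eqToHom hv = (E a).app a ≫ epiPart g at hp
  rw [hE, Category.id_comp, Category.id_comp] at hp
  refine ⟨im f, epiPart f, imIncl f, eqToHom hv ≫ imIncl g, incl_imIncl f,
    incl_eqToHom_comp hv _ (incl_imIncl g), (epiPart_imIncl f).symm, ?_⟩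
  exact (epiPart_imIncl g).symm.trans
    ((congrArg (· ≫ imIncl g) hp.symm).trans (Category.assoc _ _ _))

theorem coneOf_injective {a b : C} {f g : a ⟶ b} (h : coneOf E f = coneOf E g) : f = g := by
  obtain ⟨m, p, j, k, hj, hk, rfl, rfl⟩ := exists_factor_of_coneOf_eq hE h
  rw [incl_unique j k hj hk]

theorem incl_of_coneOf_eq {a b : C} {f : a ⟶ b} (h : coneOf E f = coneOf E (𝟙 a)) : incl f := by
  obtain ⟨m, p, j, k, hj, hk, rfl, h1⟩ := exists_factor_of_coneOf_eq hE h
  exact incl_comp _ _ (incl_of_comp p k hk (h1 ▸ incl_id a)) hj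

end Idempotents

end Cones

/-! ### The semigroup of a supported category -/

/-- The subsemigroup (in fact a right ideal) of the cones whose `ℛ`-class belongs to the
distinguished down-set. -/
def coneSubsemigroup (X : ConnectedCat.{u}) : Subsemigroup (Cone X.carrier) where
  carrier := {γ | rClass γ ∈ X.D}
  mul_mem' {_ δ} hγ _ := X.D.lower ((rClass_le_iff _ _).2 ⟨δ, rfl⟩) hγ

theorem mem_coneSubsemigroup_of_leR {X : ConnectedCat.{u}} {γ δ : Cone X.carrier} (h : LeR γ δ)
    (hδ : δ ∈ coneSubsemigroup X) : γ ∈ coneSubsemigroup X :=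
  X.D.lower ((rClass_le_iff _ _).2 h) hδ

section Supported

variable (X : SC.{u})

/-- The idempotent cone with vertex `c` that a supported category singles out. -/
noncomputable def suppCone (c : X.obj.carrier) : ConeAt c :=
  idemCone (X.property c).exists.choose_spec

theorem suppCone_isIdempotentElem (c : X.obj.carrier) :
    IsIdempotentElem (⟨c, suppCone X c⟩ : Cone X.obj.carrier) :=
  idemCone_idem _

theorem suppCone_app (c : X.obj.carrier) : (suppCone X c).app c = 𝟙 c :=
  Cone.app_vertex_of_idem (suppCone_isIdempotentElem X c)

theorem suppCone_mem (c : X.obj.carrier) :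
    (⟨c, suppCone X c⟩ : Cone X.obj.carrier) ∈ coneSubsemigroup X.obj := by
  change rClass _ ∈ X.obj.D
  rw [suppCone, rClass_idemCone]
  exact Subtype.mem _

variable {X}

theorem eq_suppCone {c : X.obj.carrier} {ε : ConeAt c}
    (hε : IsIdempotentElem (⟨c, ε⟩ : Cone X.obj.carrier))
    (hmem : (⟨c, ε⟩ : Cone X.obj.carrier) ∈ coneSubsemigroup X.obj) : ε = suppCone X c := by
  refine idemCone_unique _ ε hε ?_
  have h : ConnectedBy c (⟨rClass ⟨c, ε⟩, hmem⟩ : X.obj.D).1 := ⟨ε, hε, rfl⟩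
  exact congrArg Subtype.val ((X.property c).unique h (X.property c).exists.choose_spec)

theorem eq_suppCone_of_idem {γ : Cone X.obj.carrier} (hγ : IsIdempotentElem γ)
    (hmem : γ ∈ coneSubsemigroup X.obj) : γ = ⟨γ.vertex, suppCone X γ.vertex⟩ := by
  obtain ⟨c, ε⟩ := γ
  rw [eq_suppCone hγ hmem]

theorem connectedBy_iff {c : X.obj.carrier} {d : X.obj.D} :
    ConnectedBy c d.1 ↔ rClass ⟨c, suppCone X c⟩ = d.1 := by
  refine ⟨?_, fun h => ⟨_, suppCone_isIdempotentElem X c, h⟩⟩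
  rintro ⟨ε, hε, h⟩
  rw [← h, ← eq_suppCone hε (show rClass _ ∈ X.obj.D from h ▸ d.2)]

theorem idemCone_eq_suppCone {c : X.obj.carrier} {d : X.obj.D} (h : ConnectedBy c d.1) :
    idemCone h = suppCone X c :=
  (idemCone_unique h _ (suppCone_isIdempotentElem X c) (connectedBy_iff.1 h)).symm

variable (X)

/-- The element of the semigroup of a supported category given by a morphism. -/
noncomputable def homCone {a b : X.obj.carrier} (f : a ⟶ b) : coneSubsemigroup X.obj :=
  ⟨coneOf (suppCone X) f, mem_coneSubsemigroup_of_leR (leR_coneOf _ f) (suppCone_mem X a)⟩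

/-- The idempotent at an object of the semigroup of a supported category. -/
noncomputable def idemAt (a : X.obj.carrier) : coneSubsemigroup X.obj :=
  ⟨⟨a, suppCone X a⟩, suppCone_mem X a⟩

theorem idemAt_isIdempotentElem (a : X.obj.carrier) : IsIdempotentElem (idemAt X a) :=
  Subtype.ext (suppCone_isIdempotentElem X a)

theorem homCone_id (a : X.obj.carrier) : homCone X (𝟙 a) = idemAt X a :=
  Subtype.ext (coneOf_id _ a)

theorem homCone_comp {a b c : X.obj.carrier} (f : a ⟶ b) (g : b ⟶ c) :
    homCone X (f ≫ g) = homCone X f * homCone X g :=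
  Subtype.ext (coneOf_comp (suppCone_app X) f g)

theorem homCone_mul {a b c d : X.obj.carrier} (f : a ⟶ b) (g : c ⟶ d) :
    homCone X f * homCone X g = homCone X (f ≫ (suppCone X c).app b ≫ g) :=
  Subtype.ext (coneOf_mul _ f g)

theorem homCone_comp_incl {a b c : X.obj.carrier} (f : a ⟶ b) (j : b ⟶ c) (hj : incl j) :
    homCone X (f ≫ j) = homCone X f :=
  Subtype.ext (coneOf_comp_incl _ f j hj)

theorem idemAt_mul_homCone {a c d : X.obj.carrier} (g : c ⟶ d) :
    idemAt X a * homCone X g = homCone X ((suppCone X c).app a ≫ g) := by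
  rw [← homCone_id, homCone_mul, Category.id_comp]

theorem idemAt_mul_homCone_self {a b : X.obj.carrier} (f : a ⟶ b) :
    idemAt X a * homCone X f = homCone X f := by
  rw [← homCone_id, ← homCone_comp, Category.id_comp]

theorem homCone_mul_idemAt_self {a b : X.obj.carrier} (f : a ⟶ b) :
    homCone X f * idemAt X b = homCone X f := by
  rw [← homCone_id, ← homCone_comp, Category.comp_id]

theorem homCone_suppCone_app (a c : X.obj.carrier) :
    homCone X ((suppCone X c).app a) = idemAt X a * idemAt X c := by
  rw [← homCone_id X c, idemAt_mul_homCone, Category.comp_id]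

variable {X}

theorem homCone_injective {a b : X.obj.carrier} {f g : a ⟶ b} (h : homCone X f = homCone X g) :
    f = g :=
  coneOf_injective (suppCone_app X) (congrArg Subtype.val h)

theorem heq_of_homCone_eq {a b a' b' : X.obj.carrier} {f : a ⟶ b} {g : a' ⟶ b'} (ha : a = a')
    (hb : b = b') (h : homCone X f = homCone X g) : HEq f g := by
  subst ha hb
  rw [homCone_injective h]

theorem incl_iff_homCone {a b : X.obj.carrier} {f : a ⟶ b} :
    incl f ↔ homCone X f = idemAt X a := by
  rw [← homCone_id]
  exact ⟨fun h => Subtype.ext (coneOf_incl _ f h),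
    fun h => incl_of_coneOf_eq (suppCone_app X) (congrArg Subtype.val h)⟩

theorem exists_homCone_eq {a b : X.obj.carrier} {γ : coneSubsemigroup X.obj}
    (ha : idemAt X a * γ = γ) (hb : γ * idemAt X b = γ) : ∃ f : a ⟶ b, homCone X f = γ := by
  obtain ⟨f, hf⟩ := exists_coneOf_eq (suppCone X) (congrArg Subtype.val ha)
    (congrArg Subtype.val hb)
  exact ⟨f, Subtype.ext hf⟩

theorem eq_idemAt {γ : coneSubsemigroup X.obj} (hγ : IsIdempotentElem γ) :
    γ = idemAt X γ.1.vertex :=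
  Subtype.ext (eq_suppCone_of_idem (congrArg Subtype.val hγ) γ.2)

theorem idemAt_injective : Function.Injective (idemAt X) := fun _ _ h =>
  congrArg (fun γ => γ.1.vertex) h

/-- Every element of the semigroup is given by an isomorphism. -/
theorem exists_isIso_homCone (γ : coneSubsemigroup X.obj) :
    ∃ (c z : X.obj.carrier) (v : c ⟶ z), IsIso v ∧ homCone X v = γ := by
  obtain ⟨γ, hmem⟩ := γ
  obtain ⟨c, z, ε, v, hv, hε, rfl⟩ := γ.exists_idem_star
  -- the idempotent cone lies below the given cone, so it belongs to the semigroup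
  have hle : LeR (⟨c, ε⟩ : Cone X.obj.carrier) ⟨z, ε.star v⟩ := by
    have := leR_star (ε.star v) (inv v)
    have he : (ε.star v).star (inv v) = ε := by
      obtain ⟨f, _, _⟩ := ε
      simp [ConeAt.star]
    rwa [he] at this
  have := eq_suppCone (isIdempotentElem_of_app_vertex ε hε)
    (mem_coneSubsemigroup_of_leR hle hmem)
  subst this
  exact ⟨c, z, v, hv, Subtype.ext (coneOf_epi _ v)⟩

theorem exists_homCone (γ : coneSubsemigroup X.obj) :
    ∃ (c z : X.obj.carrier) (v : c ⟶ z), homCone X v = γ := by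
  obtain ⟨c, z, v, _, hv⟩ := exists_isIso_homCone γ
  exact ⟨c, z, v, hv⟩

theorem homCone_mul_homCone_inv {c z : X.obj.carrier} (v : c ⟶ z) [IsIso v] :
    homCone X v * homCone X (inv v) = idemAt X c := by
  rw [← homCone_comp, IsIso.hom_inv_id, homCone_id]

theorem homCone_inv_mul_homCone {c z : X.obj.carrier} (v : c ⟶ z) [IsIso v] :
    homCone X (inv v) * homCone X v = idemAt X z := by
  rw [← homCone_comp, IsIso.inv_hom_id, homCone_id]

/-- Every member of the down-set is the `ℛ`-class of the idempotent at some object. -/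
theorem exists_connectedBy (d : X.obj.D) : ∃ c : X.obj.carrier, ConnectedBy c d.1 := by
  obtain ⟨d, hd⟩ := d
  induction d using Quotient.inductionOn with | _ γ => ?_
  obtain ⟨c, z, v, hv, h⟩ := exists_isIso_homCone (X := X) ⟨γ, hd⟩
  obtain rfl : (homCone X v).1 = γ := congrArg Subtype.val h
  exact ⟨c, connectedBy_iff.2 ((rClass_eq_iff _ _).2
    ⟨⟨_, congrArg Subtype.val (homCone_mul_homCone_inv v).symm⟩, leR_coneOf _ v⟩)⟩

variable (X)

theorem isLUnipotent_coneSubsemigroup : IsLUnipotent (coneSubsemigroup X.obj) := by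
  refine ⟨fun γ => ?_, fun γ => ?_⟩
  · obtain ⟨c, z, v, hv, rfl⟩ := exists_isIso_homCone γ
    exact ⟨homCone X (inv v), by rw [homCone_mul_homCone_inv, idemAt_mul_homCone_self]⟩
  · obtain ⟨c, z, v, hv, rfl⟩ := exists_isIso_homCone γ
    refine ⟨idemAt X z, ⟨idemAt_isIdempotentElem X z,
      ⟨_, (homCone_inv_mul_homCone v).symm⟩, ⟨_, (homCone_mul_idemAt_self X v).symm⟩⟩, ?_⟩
    rintro ε ⟨hε, ⟨x, hx⟩, ⟨y, hy⟩⟩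
    have h1 : ε * idemAt X z = ε := by
      rw [hx, mul_assoc, homCone_mul_idemAt_self]
    have h2 : idemAt X z * ε = idemAt X z := by
      rw [← homCone_inv_mul_homCone v, hy, mul_assoc, mul_assoc, hε.eq]
    -- the vertices of the two idempotents are subobjects of one another
    obtain ⟨j, hj⟩ := exists_incl_of_mul_eq (congrArg Subtype.val h1)
    obtain ⟨k, hk⟩ := exists_incl_of_mul_eq (congrArg Subtype.val h2)
    rw [eq_idemAt hε]
    exact congrArg (idemAt X) (incl_antisymm j k hj hk)

end Supported

/-! ### Morphisms of supported categories as homomorphisms -/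

section Morphisms

variable {X Y : SC.{u}}

theorem CCHom.map_suppCone (m : CCHom X.obj Y.obj) (c c' : X.obj.carrier) :
    m.F.map ((suppCone X c).app c') = (suppCone Y (m.F.obj c)).app (m.F.obj c') := by
  obtain ⟨d, h⟩ := (X.property c).exists
  rw [← idemCone_eq_suppCone h, m.map_idemCone, idemCone_eq_suppCone]

/-- The functor of a morphism of supported categories respects equality of the cones given by
morphisms, also of morphisms with different domains. -/
theorem CCHom.homCone_map_eq (m : CCHom X.obj Y.obj) {a b c d : X.obj.carrier} {f : a ⟶ b}
    {g : c ⟶ d} (h : homCone X f = homCone X g) :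
    homCone Y (m.F.map f) = homCone Y (m.F.map g) := by
  -- same domain: the epimorphic components agree, and inclusions are preserved
  have same : ∀ {a b d : X.obj.carrier} {f : a ⟶ b} {g : a ⟶ d}, homCone X f = homCone X g →
      homCone Y (m.F.map f) = homCone Y (m.F.map g) := by
    intro a b d f g h
    obtain ⟨n, p, j, k, hj, hk, rfl, rfl⟩ :=
      exists_factor_of_coneOf_eq (suppCone_app X) (congrArg Subtype.val h)
    rw [m.F.map_comp, m.F.map_comp, homCone_comp_incl Y _ _ (m.map_incl j hj),
      homCone_comp_incl Y _ _ (m.map_incl k hk)]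
  -- `ε(a) γ` for a cone `γ` is expressed by a component of `ε`, which `F` preserves
  have left : ∀ {a b c d : X.obj.carrier} {f : a ⟶ b} {g : c ⟶ d}, homCone X f = homCone X g →
      homCone Y (m.F.map f) = idemAt Y (m.F.obj a) * homCone Y (m.F.map g) := by
    intro a b c d f g h
    rw [idemAt_mul_homCone, ← m.map_suppCone, ← m.F.map_comp]
    apply same
    rw [← idemAt_mul_homCone, ← h, idemAt_mul_homCone_self]
  exact (isLUnipotent_coneSubsemigroup Y).eq_of_idem_mul (idemAt_isIdempotentElem Y _)
    (idemAt_isIdempotentElem Y _) (left h) (left h.symm)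

/-- The image of a cone under a morphism of supported categories: the cone of the image of any
morphism that gives it. -/
noncomputable def CCHom.coneMap (m : CCHom X.obj Y.obj) (γ : coneSubsemigroup X.obj) :
    coneSubsemigroup Y.obj :=
  homCone Y (m.F.map (exists_homCone γ).choose_spec.choose_spec.choose)

theorem CCHom.coneMap_homCone (m : CCHom X.obj Y.obj) {a b : X.obj.carrier} (f : a ⟶ b) :
    m.coneMap (homCone X f) = homCone Y (m.F.map f) :=
  m.homCone_map_eq (exists_homCone (homCone X f)).choose_spec.choose_spec.choose_spec

/-- The homomorphism of semigroups of cones induced by a morphism of supported categories. -/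
noncomputable def CCHom.mulHom (m : CCHom X.obj Y.obj) :
    coneSubsemigroup X.obj →ₙ* coneSubsemigroup Y.obj where
  toFun := m.coneMap
  map_mul' γ δ := by
    obtain ⟨a, b, f, rfl⟩ := exists_homCone γ
    obtain ⟨c, d, g, rfl⟩ := exists_homCone δ
    rw [homCone_mul, m.coneMap_homCone, m.coneMap_homCone, m.coneMap_homCone, homCone_mul,
      m.F.map_comp, m.F.map_comp, m.map_suppCone]

theorem CCHom.mulHom_homCone (m : CCHom X.obj Y.obj) {a b : X.obj.carrier} (f : a ⟶ b) :
    m.mulHom (homCone X f) = homCone Y (m.F.map f) :=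
  m.coneMap_homCone f

theorem CCHom.mulHom_injective {m n : CCHom X.obj Y.obj} (h : m.mulHom = n.mulHom) : m = n := by
  have hmap : ∀ {a b : X.obj.carrier} (f : a ⟶ b),
      homCone Y (m.F.map f) = homCone Y (n.F.map f) := fun f => by
    rw [← m.mulHom_homCone, h, n.mulHom_homCone]
  have hobj : ∀ a, m.F.obj a = n.F.obj a := fun a => idemAt_injective <| by
    rw [← homCone_id, ← homCone_id, ← m.F.map_id, ← n.F.map_id, hmap]
  have hF : m.F = n.F :=
    Functor.hext hobj fun a b f => heq_of_homCone_eq (hobj a) (hobj b) (hmap f)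
  refine CCHom.ext hF (OrderHom.ext _ _ (funext fun d => ?_))
  obtain ⟨c, hc⟩ := exists_connectedBy d
  refine (Y.property (m.F.obj c)).unique (m.map_connected hc) ?_
  rw [hobj c]
  exact n.map_connected hc

section Preimage

variable (φ : coneSubsemigroup X.obj →ₙ* coneSubsemigroup Y.obj)

/-- The object map induced by a homomorphism of semigroups of cones, through the idempotents
of the objects. -/
noncomputable def objOfMulHom (c : X.obj.carrier) : Y.obj.carrier :=
  (φ (idemAt X c)).1.vertex

theorem map_idemAt (c : X.obj.carrier) : φ (idemAt X c) = idemAt Y (objOfMulHom φ c) :=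
  eq_idemAt ((idemAt_isIdempotentElem X c).map φ)

theorem exists_homOfMulHom {a b : X.obj.carrier} (f : a ⟶ b) :
    ∃ g : objOfMulHom φ a ⟶ objOfMulHom φ b, homCone Y g = φ (homCone X f) :=
  exists_homCone_eq (by rw [← map_idemAt, ← map_mul, idemAt_mul_homCone_self])
    (by rw [← map_idemAt, ← map_mul, homCone_mul_idemAt_self])

/-- The functor induced by a homomorphism of semigroups of cones. -/
noncomputable def functorOfMulHom : X.obj.carrier ⥤ Y.obj.carrier where
  obj := objOfMulHom φ
  map f := (exists_homOfMulHom φ f).choose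
  map_id a := homCone_injective <| by
    rw [(exists_homOfMulHom φ (𝟙 a)).choose_spec, homCone_id, homCone_id, map_idemAt]
  map_comp f g := homCone_injective <| by
    rw [(exists_homOfMulHom φ (f ≫ g)).choose_spec, homCone_comp, homCone_comp, map_mul,
      (exists_homOfMulHom φ f).choose_spec, (exists_homOfMulHom φ g).choose_spec]

theorem homCone_functorOfMulHom_map {a b : X.obj.carrier} (f : a ⟶ b) :
    homCone Y ((functorOfMulHom φ).map f) = φ (homCone X f) :=
  (exists_homOfMulHom φ f).choose_spec

theorem leR_idemAt_map {a b : X.obj.carrier} (h : LeR (idemAt X a).1 (idemAt X b).1) :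
    LeR (idemAt Y (objOfMulHom φ a)).1 (idemAt Y (objOfMulHom φ b)).1 := by
  have h1 : idemAt X b * idemAt X a = idemAt X a :=
    Subtype.ext (mul_eq_of_leR_idem (suppCone_isIdempotentElem X b) h)
  have h2 : idemAt Y (objOfMulHom φ b) * idemAt Y (objOfMulHom φ a) =
      idemAt Y (objOfMulHom φ a) := by
    rw [← map_idemAt, ← map_idemAt, ← map_mul, h1]
  exact ⟨_, congrArg Subtype.val h2.symm⟩

/-- The map of down-sets induced by a homomorphism of semigroups of cones. -/
noncomputable def classMapOfMulHom : X.obj.D →o Y.obj.D where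
  toFun d := ⟨_, (idemAt Y (objOfMulHom φ (exists_connectedBy d).choose)).2⟩
  monotone' d d' h := by
    refine (rClass_le_iff _ _).2 (leR_idemAt_map φ ((rClass_le_iff _ _).1 ?_))
    have h1 := connectedBy_iff.1 (exists_connectedBy d).choose_spec
    have h2 := connectedBy_iff.1 (exists_connectedBy d').choose_spec
    exact (h1.le.trans h).trans h2.ge

/-- The morphism of supported categories induced by a homomorphism of semigroups of cones. -/
noncomputable def ccHomOfMulHom : CCHom X.obj Y.obj where
  F := functorOfMulHom φ
  G := classMapOfMulHom φ
  map_incl j hj := by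
    rw [incl_iff_homCone, homCone_functorOfMulHom_map, incl_iff_homCone.1 hj, map_idemAt]
    rfl
  map_connected {c d} h := by
    have h1 := connectedBy_iff.1 h
    have h2 := connectedBy_iff.1 (exists_connectedBy d).choose_spec
    have h3 := (rClass_eq_iff _ _).1 (h1.trans h2.symm)
    exact connectedBy_iff.2 ((rClass_eq_iff _ _).2
      ⟨leR_idemAt_map φ h3.1, leR_idemAt_map φ h3.2⟩)
  map_idemCone {c d} h c' := by
    rw [idemCone_eq_suppCone, idemCone_eq_suppCone]
    apply homCone_injective
    rw [homCone_functorOfMulHom_map, homCone_suppCone_app, map_mul, map_idemAt, map_idemAt,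
      homCone_suppCone_app]
    rfl

theorem mulHom_ccHomOfMulHom : (ccHomOfMulHom φ).mulHom = φ := by
  ext1 γ
  obtain ⟨a, b, f, rfl⟩ := exists_homCone γ
  rw [CCHom.mulHom_homCone]
  exact homCone_functorOfMulHom_map φ f

end Preimage

end Morphisms

/-- The functor that assigns to a supported category its semigroup of cones. -/
noncomputable def coneFunctor : SC.{u} ⥤ LUS.{u} where
  obj X := ⟨Semigrp.of (coneSubsemigroup X.obj), isLUnipotent_coneSubsemigroup X⟩
  map {X Y} m := ObjectProperty.homMk (Semigrp.ofHom (CCHom.mulHom (X := X) (Y := Y) m.hom))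
  map_id X := by
    refine ObjectProperty.hom_ext _ (Semigrp.hom_ext (DFunLike.ext _ _ fun γ => ?_))
    obtain ⟨a, b, f, rfl⟩ := exists_homCone γ
    exact CCHom.mulHom_homCone _ f
  map_comp {X Y Z} m n := by
    refine ObjectProperty.hom_ext _ (Semigrp.hom_ext (DFunLike.ext _ _ fun γ => ?_))
    obtain ⟨a, b, f, rfl⟩ := exists_homCone γ
    refine (CCHom.mulHom_homCone _ f).trans ?_
    change _ = CCHom.mulHom (X := Y) (Y := Z) n.hom (CCHom.mulHom (X := X) (Y := Y) m.hom _)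
    rw [CCHom.mulHom_homCone, CCHom.mulHom_homCone]
    rfl

instance : coneFunctor.{u}.Faithful where
  map_injective {X Y} m n h := by
    refine ObjectProperty.hom_ext _ (CCHom.mulHom_injective (X := X) (Y := Y) ?_)
    exact congrArg (fun k => Semigrp.Hom.hom (InducedCategory.Hom.hom k)) h

instance : coneFunctor.{u}.Full where
  map_surjective {X Y} φ :=
    ⟨ObjectProperty.homMk (ccHomOfMulHom (X := X) (Y := Y) φ.hom.hom), by
      refine ObjectProperty.hom_ext _ (Semigrp.hom_ext ?_)
      exact mulHom_ccHomOfMulHom (X := X) (Y := Y) φ.hom.hom⟩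

/-! ### The category of idempotents of an `ℒ`-unipotent semigroup -/

/-- The idempotents of an `ℒ`-unipotent semigroup `S`; they stand for its principal left ideals,
each of which is generated by a single idempotent. -/
@[ext]
structure IdemObj (S : LUS.{u}) : Type u where
  val : S.obj
  isIdem : IsIdempotentElem val

section Idempotents

variable {S : LUS.{u}}

/-- The morphisms from `e` to `f` are the elements of `e S f`, that is, the right translations
from `S e` to `S f`. -/
instance : SmallCategory (IdemObj S) where
  Hom e f := {s : S.obj // e.val * s = s ∧ s * f.val = s}
  id e := ⟨e.val, e.isIdem, e.isIdem⟩
  comp s t := ⟨s.1 * t.1, by rw [← mul_assoc, s.2.1], by rw [mul_assoc, t.2.2]⟩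
  id_comp s := Subtype.ext s.2.1
  comp_id s := Subtype.ext s.2.2
  assoc s t w := Subtype.ext (mul_assoc s.1 t.1 w.1)

namespace IdemObj

theorem hom_ext {e f : IdemObj S} {s t : e ⟶ f} (h : s.1 = t.1) : s = t :=
  Subtype.ext h

/-- The morphism with a given underlying element. -/
def homMk {e f : IdemObj S} (s : S.obj) (h : e.val * s = s) (h' : s * f.val = s) : e ⟶ f :=
  ⟨s, h, h'⟩

/-- The inclusions are the morphisms `e ⟶ f` given by the element `e`, that is, the inclusions
`S e ⊆ S f`. -/
instance : CategoryWithSubobjects (IdemObj S) where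
  incl := fun e _ s => s.1 = e.val
  incl_id _ := rfl
  incl_comp {a _ _} f g hf hg := by
    change f.1 * g.1 = a.val
    rw [hg, f.2.2, hf]
  incl_unique f g hf hg := hom_ext (hf.trans hg.symm)
  incl_antisymm {a b} f g hf hg := IdemObj.ext <|
    S.property.eq_of_idem a.isIdem b.isIdem (hf ▸ f.2.2) (hg ▸ g.2.2)
  incl_mono f hf := ⟨fun g h hgh => hom_ext <| by
    have := congrArg Subtype.val hgh
    change g.1 * f.1 = h.1 * f.1 at this
    rwa [hf, g.2.2, h.2.2] at this⟩
  incl_of_comp {a _ _} h g hg hgh := by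
    change h.1 * g.1 = a.val at hgh
    rwa [hg, h.2.2] at hgh

theorem incl_iff {e f : IdemObj S} {s : e ⟶ f} : incl s ↔ s.1 = e.val := Iff.rfl

theorem exists_mul_mul_eq (a : S.obj) : ∃ y, a * (y * a) = a := by
  obtain ⟨y, hy⟩ := S.property.1 a
  exact ⟨y, by rw [← mul_assoc, hy]⟩

instance : NormalCategory (IdemObj S) where
  incl_splits {a b} j hj := by
    have hab : a.val * b.val = a.val := hj ▸ j.2.2
    refine ⟨homMk (b.val * a.val) (by rw [← mul_assoc, b.isIdem.eq])
      (by rw [mul_assoc, a.isIdem.eq]), hom_ext ?_⟩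
    change j.1 * (b.val * a.val) = a.val
    rw [incl_iff.1 hj, ← mul_assoc, hab, a.isIdem.eq]
  normal_factorisation {e f} s := by
    obtain ⟨s, hes, hsf⟩ := s
    obtain ⟨y, hy⟩ := exists_mul_mul_eq s
    have hy' : ∀ t, s * (y * (s * t)) = s * t := fun t => by
      have := congrArg (· * t) hy
      simpa only [mul_assoc] using this
    have hes' : ∀ t, e.val * (s * t) = s * t := fun t => by rw [← mul_assoc, hes]
    -- the idempotents `s y e` and `y s` are `ℛ`-related and `ℒ`-related to `s`, respectively
    let a : IdemObj S := ⟨s * (y * e.val), by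
      simp only [IsIdempotentElem, mul_assoc, hes', hy']⟩
    let b : IdemObj S := ⟨y * s, by simp only [IsIdempotentElem, mul_assoc, hy]⟩
    let q : e ⟶ a := homMk (s * (y * e.val)) (hes' _) a.isIdem
    let v : a ⟶ b := homMk s (by simp only [a, mul_assoc, hes, hy]) hy
    let w : b ⟶ a := homMk (y * (s * (y * e.val))) (by simp only [b, mul_assoc, hy'])
      (by simp only [a, mul_assoc, hes', hy'])
    let j : b ⟶ f := homMk (y * s) b.isIdem (by rw [mul_assoc, hsf])
    refine ⟨a, b, q, v, j, ?_, ⟨w, hom_ext ?_, hom_ext ?_⟩, rfl, hom_ext ?_⟩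
    · refine ⟨homMk a.val a.isIdem (by simp only [a, mul_assoc, e.isIdem.eq]), rfl, hom_ext ?_⟩
      exact a.isIdem
    · exact hy' _
    · change y * (s * (y * e.val)) * s = y * s
      simp only [mul_assoc, hes, hy]
    · change s = s * (y * e.val) * (s * (y * s))
      simp only [hy, mul_assoc, hes]
  exists_idem_cone c := by
    refine ⟨⟨fun f => homMk (f.val * c.val) (by rw [← mul_assoc, f.isIdem.eq])
      (by rw [mul_assoc, c.isIdem.eq]), fun {a b} j hj => hom_ext ?_, c, ?_⟩, hom_ext c.isIdem⟩
    · change j.1 * (b.val * c.val) = a.val * c.val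
      rw [← mul_assoc, j.2.2, hj]
    · have : homMk (c.val * c.val) (by rw [c.isIdem.eq, c.isIdem.eq])
          (by rw [c.isIdem.eq, c.isIdem.eq]) = 𝟙 c := hom_ext c.isIdem
      rw [this]
      infer_instance

theorem epi_iff {e f : IdemObj S} {p : e ⟶ f} : Epi p ↔ ∃ w, w * p.1 = f.val := by
  refine ⟨fun h => ?_, fun ⟨w, hw⟩ => ?_⟩
  · have := isSplitEpi_of_epi p
    exact ⟨(section_ p).1, congrArg Subtype.val (IsSplitEpi.id p)⟩
  · have : IsSplitEpi p := ⟨⟨⟨homMk (f.val * (w * e.val)) (by rw [← mul_assoc, f.isIdem.eq])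
      (by rw [mul_assoc, mul_assoc, e.isIdem.eq]), hom_ext (by
        change f.val * (w * e.val) * p.1 = f.val
        rw [mul_assoc, mul_assoc, p.2.1, hw, f.isIdem.eq])⟩⟩⟩
    infer_instance

end IdemObj

open IdemObj

/-! ### Principal cones -/

/-- The principal cone given by `a`, with vertex the idempotent `z` that is `ℒ`-related to `a`:
its components are the right translations by `a`. -/
def principalConeAt (a : S.obj) (z : IdemObj S) (h : GreenL z.val a) : ConeAt z where
  app e := homMk (e.val * a) (by rw [← mul_assoc, e.isIdem.eq])
    (by rw [mul_assoc, mul_eq_of_greenL z.isIdem h])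
  incl_app {b c} j hj := hom_ext <| by
    change j.1 * (c.val * a) = b.val * a
    rw [← mul_assoc, j.2.2, hj]
  exists_iso := by
    obtain ⟨y, hy⟩ := exists_mul_mul_eq a
    obtain ⟨w, hw⟩ := h.1
    have ha := mul_eq_of_greenL z.isIdem h
    have he : IsIdempotentElem (a * y) := by
      rw [IsIdempotentElem, mul_assoc, ← mul_assoc y, ← mul_assoc, hy]
    refine ⟨⟨a * y, he⟩, homMk (z.val * y) (by rw [← mul_assoc, z.isIdem.eq]) ?_,
      hom_ext ?_, hom_ext ?_⟩
    · change z.val * y * (a * y) = z.val * y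
      rw [hw, mul_assoc w a y, mul_assoc, he.eq]
    · change a * y * a * (z.val * y) = a * y
      rw [mul_assoc a y a, hy, ← mul_assoc, ha]
    · change z.val * y * (a * y * a) = z.val
      rw [hw, mul_assoc a y a, hy]
      simp only [mul_assoc, hy]

/-- The idempotent that is `ℒ`-related to a given element. -/
noncomputable def rightIdem (a : S.obj) : IdemObj S :=
  ⟨(S.property.2 a).choose, (S.property.2 a).choose_spec.1.1⟩

theorem greenL_rightIdem (a : S.obj) : GreenL (rightIdem a).val a :=
  (S.property.2 a).choose_spec.1.2

theorem eq_rightIdem {a : S.obj} {z : IdemObj S} (h : GreenL z.val a) : z = rightIdem a :=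
  IdemObj.ext ((S.property.2 a).unique ⟨z.isIdem, h⟩ ⟨(rightIdem a).isIdem, greenL_rightIdem a⟩)

theorem mul_rightIdem (a : S.obj) : a * (rightIdem a).val = a :=
  mul_eq_of_greenL (rightIdem a).isIdem (greenL_rightIdem a)

theorem mul_mul_rightIdem (a b : S.obj) : a * (b * (rightIdem (a * b)).val) = a * b := by
  rw [← mul_assoc, mul_rightIdem]

/-- The principal cone given by an element. -/
noncomputable def principalCone (a : S.obj) : Cone (IdemObj S) :=
  ⟨rightIdem a, principalConeAt a (rightIdem a) (greenL_rightIdem a)⟩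

theorem principalCone_eq {a : S.obj} {z : IdemObj S} (h : GreenL z.val a) :
    principalCone a = ⟨z, principalConeAt a z h⟩ := by
  obtain rfl := eq_rightIdem h
  rfl

theorem principalCone_mul (a b : S.obj) :
    principalCone (a * b) = principalCone a * principalCone b := by
  obtain ⟨x, hx⟩ := (greenL_rightIdem a).1
  obtain ⟨w, hw⟩ := (greenL_rightIdem (a * b)).1
  have ha : ∀ t, a * ((rightIdem a).val * t) = a * t := fun t => by
    rw [← mul_assoc, mul_rightIdem]
  let p : rightIdem a ⟶ rightIdem (a * b) := homMk ((rightIdem a).val * b)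
    (by rw [← mul_assoc, (rightIdem a).isIdem.eq])
    (by rw [hx, mul_assoc, mul_assoc, mul_assoc, mul_mul_rightIdem])
  let j : rightIdem (a * b) ⟶ rightIdem b := homMk (rightIdem (a * b)).val
    (rightIdem (a * b)).isIdem (by rw [hw, mul_assoc, mul_assoc, mul_rightIdem])
  have hp : Epi p := epi_iff.2 ⟨w * a, by
    change w * a * ((rightIdem a).val * b) = _
    rw [mul_assoc, ha, hw]⟩
  refine (@Cone.mul_eq_of (IdemObj S) _ _ (principalCone a) (principalCone b)
    (principalCone (a * b)) p j hp rfl (hom_ext ?_) fun c => hom_ext ?_).symm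
  · exact p.2.2.symm
  · change c.val * (a * b) = c.val * a * ((rightIdem a).val * b)
    rw [mul_assoc, ha]

theorem principalCone_injective :
    Function.Injective (principalCone : S.obj → Cone (IdemObj S)) := by
  have key : ∀ {a b : S.obj}, principalCone a = principalCone b →
      ∃ e, IsIdempotentElem e ∧ a = e * b := by
    intro a b h
    obtain ⟨y, hy⟩ := exists_mul_mul_eq a
    have he : IsIdempotentElem (a * y) := by
      rw [IsIdempotentElem, mul_assoc, ← mul_assoc y, ← mul_assoc, hy]
    -- compare the components of the two cones at the idempotent `a y`
    have hval : ∀ γ : Cone (IdemObj S), principalCone a = γ →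
        a * y * a = (γ.app ⟨a * y, he⟩).1 := by
      rintro _ rfl
      rfl
    refine ⟨a * y, he, ?_⟩
    have := hval _ h
    rw [mul_assoc, hy] at this
    exact this
  intro a b h
  obtain ⟨e, he, hab⟩ := key h
  obtain ⟨g, hg, hba⟩ := key h.symm
  exact S.property.eq_of_idem_mul he hg hab hba

/-- The principal cones form a right ideal. -/
theorem principalCone_mul_cone (a : S.obj) (δ : Cone (IdemObj S)) :
    ∃ b, principalCone b = principalCone a * δ := by
  let p : rightIdem a ⟶ im (δ.app (rightIdem a)) := epiPart (δ.app (rightIdem a))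
  obtain ⟨w, hw⟩ := epi_iff.1 (epi_epiPart (δ.app (rightIdem a)))
  change w * p.1 = _ at hw
  obtain ⟨x, hx⟩ := (greenL_rightIdem a).1
  have h : GreenL (im (δ.app (rightIdem a))).val (a * p.1) := by
    refine ⟨⟨w * x, ?_⟩, ⟨a * p.1, ?_⟩⟩
    · exact (by rw [mul_assoc, ← mul_assoc x, ← hx, p.2.1, hw] : w * x * (a * p.1) = _).symm
    · rw [mul_assoc, p.2.2]
  refine ⟨a * p.1, ?_⟩
  rw [principalCone_eq h]
  refine Cone.ext_of rfl fun c => hom_ext ?_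
  change c.val * (a * p.1) * (im (δ.app (rightIdem a))).val = c.val * a * p.1
  rw [mul_assoc, mul_assoc a, p.2.2, mul_assoc]

end Idempotents

/-! ### Every `ℒ`-unipotent semigroup is the semigroup of a supported category -/

section Supported

variable (S : LUS.{u})

open IdemObj

theorem exists_principalCone_of_leR {S : LUS.{u}} {γ : Cone (IdemObj S)} {a : S.obj}
    (h : LeR γ (principalCone a)) : ∃ b, principalCone b = γ := by
  obtain ⟨δ, rfl⟩ := h
  exact principalCone_mul_cone a δ

/-- The connected category of an `ℒ`-unipotent semigroup: its category of idempotents, with the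
`ℛ`-classes of the principal cones. -/
noncomputable def idemConnectedCat : ConnectedCat.{u} where
  carrier := IdemObj S
  D :=
    { carrier := {d | ∃ a : S.obj, rClass (principalCone a) = d}
      lower' := by
        rintro _ d h ⟨a, rfl⟩
        induction d using Quotient.inductionOn with | _ γ => ?_
        obtain ⟨b, rfl⟩ := exists_principalCone_of_leR ((rClass_le_iff γ (principalCone a)).1 h)
        exact ⟨b, rfl⟩ }
  connected e := by
    refine ⟨_, ⟨e.val, rfl⟩, principalConeAt e.val e (greenL_refl e.isIdem), ?_, ?_⟩
    · rw [← principalCone_eq, IsIdempotentElem, ← principalCone_mul, e.isIdem.eq]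
    · rw [← principalCone_eq]

theorem mem_coneSubsemigroup_idemConnectedCat {γ : Cone (IdemObj S)} :
    γ ∈ coneSubsemigroup (idemConnectedCat S) ↔ ∃ a : S.obj, principalCone a = γ := by
  refine ⟨?_, fun ⟨a, ha⟩ => ⟨a, congrArg rClass ha⟩⟩
  rintro ⟨a, ha⟩
  exact exists_principalCone_of_leR ((rClass_eq_iff _ _).1 ha).2

theorem isSupported_idemConnectedCat : IsSupported (idemConnectedCat S) := by
  have key : ∀ (e : IdemObj S) (d : RClasses (IdemObj S)), d ∈ (idemConnectedCat S).D →
      ConnectedBy e d → d = rClass (principalCone e.val) := by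
    rintro e d hd ⟨ε, hε, rfl⟩
    obtain ⟨b, hb⟩ := (mem_coneSubsemigroup_idemConnectedCat S).1 hd
    have hbi : IsIdempotentElem b := principalCone_injective <| by
      rw [principalCone_mul, hb, hε.eq]
    -- the idempotent cone is the principal cone of `b`, so its vertex is `b`
    have hv : rightIdem b = e := congrArg Cone.vertex hb
    rw [← eq_rightIdem (z := ⟨b, hbi⟩) (greenL_refl hbi)] at hv
    subst hv
    exact congrArg rClass hb.symm
  intro e
  obtain ⟨d, hd, h⟩ := (idemConnectedCat S).connected e
  exact ⟨⟨d, hd⟩, h, fun d' h' => Subtype.ext ((key e d'.1 d'.2 h').trans (key e d hd h).symm)⟩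

/-- An `ℒ`-unipotent semigroup is isomorphic, through its principal cones, to the semigroup of its
supported category. -/
noncomputable def principalConeEquiv : S.obj ≃* coneSubsemigroup (idemConnectedCat S) :=
  MulEquiv.ofBijective
    ({ toFun := fun a =>
        ⟨principalCone a, (mem_coneSubsemigroup_idemConnectedCat S).2 ⟨a, rfl⟩⟩
       map_mul' := fun a b => Subtype.ext (principalCone_mul a b) } :
      S.obj →ₙ* coneSubsemigroup (idemConnectedCat S))
    ⟨fun _ _ h => principalCone_injective (congrArg Subtype.val h), fun ⟨γ, hγ⟩ => by
      obtain ⟨a, rfl⟩ := (mem_coneSubsemigroup_idemConnectedCat S).1 hγ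
      exact ⟨a, rfl⟩⟩

end Supported

instance : coneFunctor.{u}.EssSurj where
  mem_essImage S := ⟨⟨idemConnectedCat S, isSupported_idemConnectedCat S⟩,
    ⟨(ObjectProperty.isoMk _ (principalConeEquiv S).toSemigrpIso).symm⟩⟩

instance : coneFunctor.{u}.IsEquivalence where

/-! ### Opposite semigroups -/

section Opposite

open MulOpposite

theorem isRegularSemigroup_op {S : Type u} [Semigroup S] (h : IsRegularSemigroup S) :
    IsRegularSemigroup Sᵐᵒᵖ := fun a => by
  obtain ⟨x, hx⟩ := h a.unop
  exact ⟨op x, unop_injective (by simpa [mul_assoc] using hx)⟩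

theorem leL_op_iff {S : Type u} [Semigroup S] {a b : S} : LeL (op a) (op b) ↔ LeR a b :=
  ⟨fun ⟨x, hx⟩ => ⟨x.unop, congrArg unop hx⟩, fun ⟨x, hx⟩ => ⟨op x, congrArg op hx⟩⟩

theorem leR_op_iff {S : Type u} [Semigroup S] {a b : S} : LeR (op a) (op b) ↔ LeL a b :=
  ⟨fun ⟨x, hx⟩ => ⟨x.unop, congrArg unop hx⟩, fun ⟨x, hx⟩ => ⟨op x, congrArg op hx⟩⟩

theorem isIdempotentElem_op_iff {S : Type u} [Semigroup S] {a : S} :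
    IsIdempotentElem (op a) ↔ IsIdempotentElem a :=
  ⟨fun h => congrArg unop h, fun h => congrArg op h⟩

theorem IsRUnipotent.op {S : Type u} [Semigroup S] (h : IsRUnipotent S) : IsLUnipotent Sᵐᵒᵖ := by
  refine ⟨isRegularSemigroup_op h.1, fun a => ?_⟩
  obtain ⟨e, ⟨he, hea⟩, huniq⟩ := h.2 a.unop
  exact ⟨.op e, ⟨isIdempotentElem_op_iff.2 he, leL_op_iff.2 hea.1, leL_op_iff.2 hea.2⟩,
    fun f hf => unop_injective (huniq f.unop
      ⟨isIdempotentElem_op_iff.1 hf.1, leL_op_iff.1 hf.2.1, leL_op_iff.1 hf.2.2⟩)⟩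

theorem IsLUnipotent.op {S : Type u} [Semigroup S] (h : IsLUnipotent S) : IsRUnipotent Sᵐᵒᵖ := by
  refine ⟨isRegularSemigroup_op h.1, fun a => ?_⟩
  obtain ⟨e, ⟨he, hea⟩, huniq⟩ := h.2 a.unop
  exact ⟨.op e, ⟨isIdempotentElem_op_iff.2 he, leR_op_iff.2 hea.1, leR_op_iff.2 hea.2⟩,
    fun f hf => unop_injective (huniq f.unop
      ⟨isIdempotentElem_op_iff.1 hf.1, leR_op_iff.1 hf.2.1, leR_op_iff.1 hf.2.2⟩)⟩

end Opposite

/-- The functor that assigns to an `ℛ`-unipotent semigroup its opposite. -/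
def opFunctor : RUS.{u} ⥤ LUS.{u} where
  obj S := ⟨Semigrp.of S.objᵐᵒᵖ, IsRUnipotent.op S.property⟩
  map f := ObjectProperty.homMk (Semigrp.ofHom (MulHom.op f.hom.hom))

instance : opFunctor.{u}.Faithful where
  map_injective h := by
    refine ObjectProperty.hom_ext _ (Semigrp.hom_ext (MulHom.op.injective ?_))
    exact congrArg (fun k => Semigrp.Hom.hom (InducedCategory.Hom.hom k)) h

instance : opFunctor.{u}.Full where
  map_surjective f :=
    ⟨ObjectProperty.homMk (Semigrp.ofHom (MulHom.op.symm f.hom.hom)), rfl⟩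

instance : opFunctor.{u}.EssSurj where
  mem_essImage S := ⟨⟨Semigrp.of S.objᵐᵒᵖ, IsLUnipotent.op S.property⟩,
    ⟨(ObjectProperty.isoMk _ (MulEquiv.opOp S.obj).toSemigrpIso).symm⟩⟩

instance : opFunctor.{u}.IsEquivalence where

end NormalCat

theorem theorem4 :
    Nonempty (NormalCat.LUS.{u} ≌ NormalCat.SC.{u}) ∧
      Nonempty (NormalCat.RUS.{u} ≌ NormalCat.SC.{u}) :=
  ⟨⟨NormalCat.coneFunctor.asEquivalence.symm⟩,
    ⟨NormalCat.opFunctor.asEquivalence.trans NormalCat.coneFunctor.asEquivalence.symm⟩⟩
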